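/- Let $\mathscr F$ be the set of all entire functions $\varPhi(z)=\sum_{k=0}^\infty a_k z^k$ $(z\in\mathbb C)$ with $a_k\ge 0$ for all $k\ge 0$ and $a_k>0$ for some $k\ge 1$; put $\mathscr Z_\varPhi=\{k\in\mathbb Z_+: a_k>0\}$. Let $\mathcal H$ be a complex Hilbert space with $\dim\mathcal H\ge 1$, and let $\varPhi(\mathcal H)$ be the reproducing kernel Hilbert space of complex functions on $\mathcal H$ with reproducing kernel $K^\varPhi(\xi,\eta)=\varPhi(\langle\xi,\eta\rangle)$, $\xi,\eta\in\mathcal H$ (the inner product being linear in its first argument). For a bounded linear operator $A$ on $\mathcal H$, let $C_A$ be the composition operator in $\varPhi(\mathcal H)$ with domain $\{f\in\varPhi(\mathcal H): f\circ A\in\varPhi(\mathcal H)\}$, given by $C_Af=f\circ A$. For a complex Hilbert space $\mathcal K$, write $\mathbf B(\mathcal K)$ for the set of bounded linear operators defined on all of $\mathcal K$, and $r(T)$ for the spectral radius of $T\in\mathbf B(\mathcal K)$. For $m\in\mathbb Z_+$ and $n\in\mathbb Z_+\cup\{\infty\}$ with $m\le n$ define $$q_{m,n}(t)=t^m\max\{1,t^{n-m}\}\in[0,\infty],\qquad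 t\in[0,\infty),$$ where $t^0=1$ for all $t\ge 0$, $t^\infty=\infty$ for $t>1$, $t^\infty=0$ for $0\le t<1$, and $1^\infty=1$. **Theorem.** Let $\varPhi\in\mathscr F$ and $A\in\mathbf B(\mathcal H)$. Set $m=\min\mathscr Z_\varPhi$ and $n=\sup\mathscr Z_\varPhi$. Then 1. if $n<\infty$, then $C_A\in\mathbf B(\varPhi(\mathcal H))$; 2. if $n=\infty$, then $C_A\in\mathbf B(\varPhi(\mathcal H))$ if and only if $\|A\|\le 1$. Moreover, if $C_A\in\mathbf B(\varPhi(\mathcal H))$, then $\|C_A\|=q_{m,n}(\|A\|)$ and $r(C_A)=q_{m,n}(r(A))$. -/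

import Mathlib

open scoped ENNReal InnerProductSpace ComplexOrder

noncomputable section

/-- The class `𝓕`: entire functions `Φ(z) = ∑ aₙ zⁿ` (the series converging on all of `ℂ`) with
real Taylor coefficients `aₙ ≥ 0`, at least one of which is positive for some `n ≥ 1`. -/
structure EntireF where
  /-- the entire function `Φ` -/
  toFun : ℂ → ℂ
  /-- its Taylor coefficients at the origin -/
  coeff : ℕ → ℝ
  coeff_nonneg : ∀ k, 0 ≤ coeff k
  exists_coeff_pos : ∃ k, 1 ≤ k ∧ 0 < coeff k
  hasSum : ∀ z : ℂ, HasSum (fun k => (coeff k : ℂ) * z ^ k) (toFun z)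

namespace EntireF

instance : CoeFun EntireF (fun _ => ℂ → ℂ) := ⟨toFun⟩

/-- `Z_Φ = {k : a_k > 0}`. -/
def Z (Φ : EntireF) : Set ℕ := {k | 0 < Φ.coeff k}

theorem Z_nonempty (Φ : EntireF) : Φ.Z.Nonempty :=
  let ⟨k, _, hk⟩ := Φ.exists_coeff_pos
  ⟨k, hk⟩

/-- `m = min Z_Φ`; the set is nonempty, so the infimum is attained. -/
def minZ (Φ : EntireF) : ℕ := sInf Φ.Z

/-- `n = sup Z_Φ ∈ ℕ ∪ {∞}`. -/
def supZ (Φ : EntireF) : ℕ∞ := ⨆ k ∈ Φ.Z, (k : ℕ∞)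

variable (Φ : EntireF) (H : Type*) [NormedAddCommGroup H] [InnerProductSpace ℂ H]

theorem scalarKernel_posSemidef :
    (Matrix.of fun x y : H => Φ ⟪y, x⟫_ℂ).PosSemidef := by
  -- the powers of the conjugated Gram kernel are positive semidefinite by the Schur product theorem
  have h1 : (Matrix.of fun x y : H => ⟪y, x⟫_ℂ).PosSemidef := by
    refine ⟨Matrix.ext fun x y => by simp [Matrix.conjTranspose_apply], fun f => ?_⟩
    have : (f.sum fun x a => f.sum fun y b => star a * (Matrix.of fun x y : H => ⟪y, x⟫_ℂ) x y * b)
        = ⟪f.sum fun (y : H) b => star b • y, f.sum fun (x : H) a => star a • x⟫_ℂ := by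
      simp only [Finsupp.sum, sum_inner, inner_sum, inner_smul_left, inner_smul_right,
        Finset.mul_sum, Matrix.of_apply]
      refine Finset.sum_congr rfl fun x _ => ?_
      refine Finset.sum_congr rfl fun y _ => ?_
      simp
      ring
    rw [this]
    exact RCLike.nonneg_iff.2 ⟨inner_self_nonneg, inner_self_im _⟩
  have hpow : ∀ n : ℕ, (Matrix.of fun x y : H => ⟪y, x⟫_ℂ ^ n).PosSemidef := by
    intro n
    induction n with
    | zero =>
      refine ⟨Matrix.ext fun x y => by simp [Matrix.conjTranspose_apply], fun f => ?_⟩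
      have : (f.sum fun x a => f.sum fun y b =>
          star a * (Matrix.of fun x y : H => ⟪y, x⟫_ℂ ^ 0) x y * b)
          = star (f.sum fun _ a => a) * (f.sum fun _ b => b) := by
        simp [Finsupp.sum, Finset.sum_mul_sum]
      rw [this]
      exact star_mul_self_nonneg _
    | succ n ih =>
      have : (Matrix.of fun x y : H => ⟪y, x⟫_ℂ ^ (n + 1))
          = Matrix.hadamard (Matrix.of fun x y : H => ⟪y, x⟫_ℂ ^ n)
            (Matrix.of fun x y : H => ⟪y, x⟫_ℂ) := by
        ext x y
        simp [pow_succ]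
      rw [this]
      exact ih.hadamard h1
  refine ⟨Matrix.ext fun x y => ?_, fun f => ?_⟩
  · have h2 := (Φ.hasSum ⟪x, y⟫_ℂ).star
    have h3 := Φ.hasSum ⟪y, x⟫_ℂ
    simp only [Matrix.conjTranspose_apply, Matrix.of_apply]
    refine h2.unique ?_
    convert h3 using 2
    simp
  · have hs : HasSum (fun k => f.sum fun x a => f.sum fun y b =>
        star a * ((Φ.coeff k : ℂ) * ⟪y, x⟫_ℂ ^ k) * b)
        (f.sum fun x a => f.sum fun y b => star a * Φ ⟪y, x⟫_ℂ * b) :=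
      hasSum_sum fun x _ => hasSum_sum fun y _ =>
        ((Φ.hasSum ⟪y, x⟫_ℂ).mul_left _).mul_right _
    refine hs.nonneg fun k => ?_
    have := ((hpow k).smul (a := Φ.coeff k) (Φ.coeff_nonneg k)).2 f
    simpa using this

/-- The kernel `K^Φ(ξ, η) = Φ(⟨ξ, η⟩)`. The inner product `⟨ξ, η⟩`, linear in `ξ`, is Mathlib's
`⟪η, ξ⟫_ℂ`; the scalar `K^Φ(ξ, η)` is regarded as an operator on `ℂ`. -/
def kernel : Matrix H H (ℂ →L[ℂ] ℂ) :=
  Matrix.of fun ξ η => Φ ⟪η, ξ⟫_ℂ • ContinuousLinearMap.id ℂ ℂ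

instance kernel_posSemidef : Fact (Φ.kernel H).PosSemidef := by
  have h := Φ.scalarKernel_posSemidef H
  have e := (RKHS.posSemidef_tfae (K := Φ.kernel H)).out 0 2
  refine ⟨e.2 ⟨Matrix.ext fun x y => ?_, fun f => ?_⟩⟩
  · have hxy := congrFun (congrFun h.1 x) y
    simp only [Matrix.conjTranspose_apply, Matrix.of_apply] at hxy
    simp only [kernel, Matrix.conjTranspose_apply, Matrix.of_apply, star_smul, hxy]
    congr 1
    exact star_one _
  · have h2 := h.2 f
    rw [Finsupp.sum_comm] at h2
    refine le_of_le_of_eq (RCLike.nonneg_iff.1 h2).1 ?_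
    rw [← RCLike.conj_re]
    congr 1
    simp only [Finsupp.sum, map_sum]
    refine Finset.sum_congr rfl fun x _ => ?_
    refine Finset.sum_congr rfl fun y _ => ?_
    simp [kernel]
    ring

/-- `Φ(H)`: the reproducing kernel Hilbert space of functions on `H` with kernel `K^Φ`. -/
abbrev Space := RKHS.OfKernel (Φ.kernel H)

variable {H}

/-- The composition operator `C_φ` in `Φ(H)`: the (possibly unbounded, possibly not densely
defined) operator `f ↦ f ∘ φ` with domain `{f ∈ Φ(H) : f ∘ φ ∈ Φ(H)}`. -/
def compOp (φ : H → H) : Φ.Space H →ₗ.[ℂ] Φ.Space H where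
  domain :=
    { carrier := {f | ∃ g : Φ.Space H, (g : H → ℂ) = f ∘ φ}
      add_mem' := by
        rintro f₁ f₂ ⟨g₁, h₁⟩ ⟨g₂, h₂⟩
        exact ⟨g₁ + g₂, by rw [RKHS.coe_add, RKHS.coe_add, h₁, h₂]; rfl⟩
      zero_mem' := ⟨0, by rw [RKHS.coe_zero]; rfl⟩
      smul_mem' := by
        rintro c f ⟨g, h⟩
        exact ⟨c • g, by rw [RKHS.coe_smul, RKHS.coe_smul, h]; rfl⟩ }
  toFun :=
    { toFun := fun f => f.2.choose
      map_add' := fun f₁ f₂ => DFunLike.coe_injective (by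
        rw [(f₁ + f₂).2.choose_spec, RKHS.coe_add, f₁.2.choose_spec, f₂.2.choose_spec,
          Submodule.coe_add, RKHS.coe_add]; rfl)
      map_smul' := fun c f => DFunLike.coe_injective (by
        rw [(c • f).2.choose_spec, RingHom.id_apply, RKHS.coe_smul, f.2.choose_spec,
          Submodule.coe_smul, RKHS.coe_smul]; rfl) }

theorem mem_compOp_domain {φ : H → H} {f : Φ.Space H} :
    f ∈ (Φ.compOp φ).domain ↔ ∃ g : Φ.Space H, (g : H → ℂ) = f ∘ φ := Iff.rfl

theorem coe_compOp_apply {φ : H → H} (f : (Φ.compOp φ).domain) :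
    (Φ.compOp φ f : H → ℂ) = (f : Φ.Space H) ∘ φ := f.2.choose_spec

end EntireF

/-- The operator `S` in `E` is the everywhere defined bounded operator `T ∈ B(E)`. -/
def LinearPMap.EqBounded {E : Type*} [NormedAddCommGroup E] [NormedSpace ℂ E]
    (S : E →ₗ.[ℂ] E) (T : E →L[ℂ] E) : Prop :=
  S = (T : E →ₗ[ℂ] E).toPMap ⊤

/-- `S ∈ B(E)`: the operator `S` is defined on the whole of `E` and bounded. -/
def LinearPMap.MemBounded {E : Type*} [NormedAddCommGroup E] [NormedSpace ℂ E]
    (S : E →ₗ.[ℂ] E) : Prop :=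
  ∃ T : E →L[ℂ] E, S.EqBounded T

/-- `t ^ n` for `n ∈ ℕ ∪ {∞}`: `t ^ 0 = 1`, and `t ^ ∞` is `0`, `1` or `∞` according as
`t < 1`, `t = 1` or `t > 1`. -/
def extPow (t : ℝ≥0∞) : ℕ∞ → ℝ≥0∞
  | (k : ℕ) => t ^ k
  | ⊤ => if t < 1 then 0 else if t = 1 then 1 else ⊤

/-- `q_{m,n}(t) = t ^ m * max {1, t ^ (n - m)}` (used for `m ≤ n`). -/
def qFun (m : ℕ) (n : ℕ∞) (t : ℝ≥0∞) : ℝ≥0∞ := t ^ m * max 1 (extPow t (n - m))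

end

/-! ### Domination between powers of Gram kernels -/

section PosSemidef

variable {H : Type*} [NormedAddCommGroup H] [InnerProductSpace ℂ H]

/-! Everything goes through the kernel functions `K_x`, since `C_A` has adjoint `K_x ↦ K_{Ax}`.
Upper bound: by the Schur product theorem the kernel `⟪A y, A x⟫ ^ k` is dominated by `‖A‖ ^ (2k)
⟪y, x⟫ ^ k`; summing over `k` with weights `a_k` shows that `K_x ↦ K_{Ax}` is bounded by any `c`
majorizing `‖A‖ ^ k` on `Z_Φ`, and `C_A` is the adjoint of its extension (`exists_eqBounded`). Lower
bound: `‖K_{Ax}‖ ≤ ‖C_A‖ ‖K_x‖` on the ray through `x` reads `Φ(b t) ≤ c Φ(t)` for `t > 0`, with `b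
= (‖A x‖ / ‖x‖) ^ 2` and `c = ‖C_A‖ ^ 2`. Small `t` yields `b ^ m ≤ c`; large `t` yields `b ^ k ≤ c`
for `k ∈ Z_Φ` when `b ≥ 1` (`pow_minZ_le`, `pow_le_of_mem`). Spectral radius: `C_A ^ k = C_{A ^ k}`,
so the norm formula passes through Gelfand's formula. -/

theorem sum_star_mul_inner_mul (B : H →L[ℂ] H) (f : H →₀ ℂ) :
    (f.sum fun x a => f.sum fun y b => star a * ⟪B y, B x⟫_ℂ * b)
      = ((‖B (f.sum fun x a => star a • x)‖ ^ 2 : ℝ) : ℂ) := by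
  have h : B (f.sum fun x a => star a • x) = f.sum fun x a => star a • B x := by
    simp [Finsupp.sum, map_sum]
  rw [Complex.ofReal_pow]
  have e := inner_self_eq_norm_sq_to_K (𝕜 := ℂ) (B (f.sum fun x a => star a • x))
  refine Eq.trans ?_ e
  rw [h]
  simp only [Finsupp.sum, sum_inner, inner_sum, inner_smul_left, inner_smul_right,
    Finset.mul_sum]
  refine Finset.sum_congr rfl fun x _ => ?_
  refine Finset.sum_congr rfl fun y _ => ?_
  simp
  ring

theorem posSemidef_inner_map (B : H →L[ℂ] H) :
    (Matrix.of fun x y : H => ⟪B y, B x⟫_ℂ).PosSemidef := by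
  refine ⟨Matrix.ext fun x y => by simp [Matrix.conjTranspose_apply], fun f => ?_⟩
  simp only [Matrix.of_apply]
  rw [sum_star_mul_inner_mul]
  exact Complex.zero_le_real.2 (sq_nonneg _)

theorem posSemidef_norm_sq_mul_inner_sub (A : H →L[ℂ] H) :
    (Matrix.of fun x y : H => ((‖A‖ ^ 2 : ℝ) : ℂ) * ⟪y, x⟫_ℂ - ⟪A y, A x⟫_ℂ).PosSemidef := by
  refine ⟨Matrix.ext fun x y => by simp [Matrix.conjTranspose_apply], fun f => ?_⟩
  have h1 := sum_star_mul_inner_mul A f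
  have h2 := sum_star_mul_inner_mul (ContinuousLinearMap.id ℂ H) f
  simp only [ContinuousLinearMap.id_apply] at h2
  have : (f.sum fun x a => f.sum fun y b =>
      star a * (Matrix.of fun x y : H => ((‖A‖ ^ 2 : ℝ) : ℂ) * ⟪y, x⟫_ℂ - ⟪A y, A x⟫_ℂ) x y * b)
      = ((‖A‖ ^ 2 * ‖f.sum fun x a => star a • x‖ ^ 2
        - ‖A (f.sum fun x a => star a • x)‖ ^ 2 : ℝ) : ℂ) := by
    rw [Complex.ofReal_sub, Complex.ofReal_mul, ← h1, ← h2]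
    simp only [Finsupp.sum, Matrix.of_apply, Finset.mul_sum, ← Finset.sum_sub_distrib]
    refine Finset.sum_congr rfl fun x _ => Finset.sum_congr rfl fun y _ => ?_
    ring
  rw [this, Complex.zero_le_real, sub_nonneg, ← mul_pow]
  gcongr
  exact A.le_opNorm _

theorem posSemidef_inner_map_pow (B : H →L[ℂ] H) (k : ℕ) :
    (Matrix.of fun x y : H => ⟪B y, B x⟫_ℂ ^ k).PosSemidef := by
  induction k with
  | zero =>
    refine ⟨Matrix.ext fun x y => by simp [Matrix.conjTranspose_apply], fun f => ?_⟩
    have : (f.sum fun x a => f.sum fun y b =>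
        star a * (Matrix.of fun x y : H => ⟪B y, B x⟫_ℂ ^ 0) x y * b)
        = star (f.sum fun _ a => a) * (f.sum fun _ b => b) := by
      simp [Finsupp.sum, Finset.sum_mul_sum]
    rw [this]
    exact star_mul_self_nonneg _
  | succ k ih =>
    have e : (Matrix.of fun x y : H => ⟪B y, B x⟫_ℂ ^ (k + 1))
        = (Matrix.of fun x y : H => ⟪B y, B x⟫_ℂ ^ k).hadamard
          (Matrix.of fun x y : H => ⟪B y, B x⟫_ℂ) := by
      ext x y
      simp [pow_succ]
    rw [e]
    exact ih.hadamard (posSemidef_inner_map B)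

/-- Powers of the Gram kernel: `⟪A y, A x⟫ ^ k ≤ ‖A‖ ^ (2 k) ⟪y, x⟫ ^ k` as kernels. -/
theorem posSemidef_norm_pow_mul_inner_pow_sub (A : H →L[ℂ] H) (k : ℕ) :
    (Matrix.of fun x y : H =>
      (((‖A‖ ^ k) ^ 2 : ℝ) : ℂ) * ⟪y, x⟫_ℂ ^ k - ⟪A y, A x⟫_ℂ ^ k).PosSemidef := by
  induction k with
  | zero =>
    have e : (Matrix.of fun x y : H =>
        (((‖A‖ ^ 0) ^ 2 : ℝ) : ℂ) * ⟪y, x⟫_ℂ ^ 0 - ⟪A y, A x⟫_ℂ ^ 0) = 0 := by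
      ext x y
      simp
    rw [e]
    exact Matrix.PosSemidef.zero
  | succ k ih =>
    -- With `s = ‖A‖ ^ 2`, `G = ⟪y, x⟫`, `G' = ⟪A y, A x⟫`, telescope: `(sG)^(k+1) - G'^(k+1) =
    -- (sG)^k (sG - G') + ((sG)^k - G'^k) G'`, where both products are Schur products of positive
    -- kernels.
    have h1 := ((posSemidef_inner_map_pow (ContinuousLinearMap.id ℂ H) k).smul
      (sq_nonneg (‖A‖ ^ k))).hadamard (posSemidef_norm_sq_mul_inner_sub A)
    have h2 := h1.add (ih.hadamard (posSemidef_inner_map A))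
    refine (congrArg Matrix.PosSemidef (Matrix.ext fun x y => ?_)).mp h2
    simp
    ring

end PosSemidef

/-! ### Kernel functions and construction of the bounded operator -/

namespace EntireF

variable {H : Type*} [NormedAddCommGroup H] [InnerProductSpace ℂ H] (Φ : EntireF)

/-- Termwise comparison of the power series: exponents outside `Z_Φ` contribute nothing, so `c` need
only control those in `Z_Φ`. -/
theorem posSemidef_sq_mul_sub {A : H →L[ℂ] H} {c : ℝ} (hc : ∀ k ∈ Φ.Z, ‖A‖ ^ k ≤ c)
    (f : H →₀ ℂ) :
    (f.sum fun x a => f.sum fun y b => star a * Φ ⟪A y, A x⟫_ℂ * b).re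
      ≤ c ^ 2 * (f.sum fun x a => f.sum fun y b => star a * Φ ⟪y, x⟫_ℂ * b).re := by
  have hs : ∀ B : H →L[ℂ] H, HasSum (fun k => (f.sum fun x a => f.sum fun y b =>
      star a * ((Φ.coeff k : ℂ) * ⟪B y, B x⟫_ℂ ^ k) * b).re)
      (f.sum fun x a => f.sum fun y b => star a * Φ ⟪B y, B x⟫_ℂ * b).re := fun B =>
    Complex.hasSum_re (hasSum_sum fun x _ => hasSum_sum fun y _ =>
      ((Φ.hasSum ⟪B y, B x⟫_ℂ).mul_left _).mul_right _)
  refine hasSum_le (fun k => ?_) (hs A)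
    ((hs (ContinuousLinearMap.id ℂ H)).mul_left (c ^ 2))
  have e : ∀ B : H →L[ℂ] H, (f.sum fun x a => f.sum fun y b =>
      star a * ((Φ.coeff k : ℂ) * ⟪B y, B x⟫_ℂ ^ k) * b).re = Φ.coeff k *
      (f.sum fun x a => f.sum fun y b => star a * ⟪B y, B x⟫_ℂ ^ k * b).re := fun B => by
    rw [← Complex.re_ofReal_mul]
    congr 1
    simp only [Finsupp.sum, Finset.mul_sum]
    refine Finset.sum_congr rfl fun x _ => Finset.sum_congr rfl fun y _ => ?_
    ring
  rw [e, e]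
  rcases (Φ.coeff_nonneg k).eq_or_lt with h0 | h0
  · simp [← h0]
  have h1 := (Complex.nonneg_iff.1 ((posSemidef_inner_map_pow (ContinuousLinearMap.id ℂ H) k).2 f)).1
  have h2 := (Complex.nonneg_iff.1 ((posSemidef_norm_pow_mul_inner_pow_sub A k).2 f)).1
  simp only [Matrix.of_apply, ContinuousLinearMap.id_apply] at h1 h2 ⊢
  have h3 : (f.sum fun x a => f.sum fun y b => star a *
      ((((‖A‖ ^ k) ^ 2 : ℝ) : ℂ) * ⟪y, x⟫_ℂ ^ k - ⟪A y, A x⟫_ℂ ^ k) * b)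
      = (((‖A‖ ^ k) ^ 2 : ℝ) : ℂ) * (f.sum fun x a => f.sum fun y b => star a * ⟪y, x⟫_ℂ ^ k * b)
        - f.sum fun x a => f.sum fun y b => star a * ⟪A y, A x⟫_ℂ ^ k * b := by
    simp only [Finsupp.sum, Finset.mul_sum, ← Finset.sum_sub_distrib]
    refine Finset.sum_congr rfl fun x _ => Finset.sum_congr rfl fun y _ => ?_
    ring
  rw [h3, Complex.sub_re, Complex.re_ofReal_mul, sub_nonneg] at h2
  rw [mul_left_comm]
  refine mul_le_mul_of_nonneg_left (h2.trans ?_) h0.le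
  gcongr
  exact hc k h0

/-- The kernel function `K^Φ(·, x)`. -/
noncomputable def ker (x : H) : Φ.Space H := RKHS.kerFun (Φ.Space H) x (1 : ℂ)

theorem inner_ker (x : H) (f : Φ.Space H) : ⟪Φ.ker x, f⟫_ℂ = f x := by
  rw [ker, RKHS.kerFun_inner]
  simp

theorem ker_apply (x y : H) : Φ.ker y x = Φ ⟪y, x⟫_ℂ := by
  rw [ker, RKHS.kerFun_apply, RKHS.OfKernel.kernel_ofKernel]
  simp [kernel]

variable (H) in
/-- The linear span map of the kernel functions. -/
noncomputable def kerSum : (H →₀ ℂ) →ₗ[ℂ] Φ.Space H := Finsupp.linearCombination ℂ Φ.ker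

theorem kerSum_single (x : H) : Φ.kerSum H (Finsupp.single x 1) = Φ.ker x := by
  simp [kerSum]

theorem denseRange_kerSum : DenseRange (Φ.kerSum H) := by
  rw [DenseRange, dense_iff_closure_eq, ← Set.univ_subset_iff]
  have h := RKHS.kerFun_dense (Φ.Space H)
  have h2 : (Submodule.span ℂ {RKHS.kerFun (Φ.Space H) x v | (x : H) (v : ℂ)})
      ≤ LinearMap.range (Φ.kerSum H) := by
    rw [Submodule.span_le]
    rintro _ ⟨x, v, rfl⟩
    refine ⟨Finsupp.single x v, ?_⟩
    rw [kerSum, Finsupp.linearCombination_single, ker, ← map_smul]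
    simp
  have h3 := Submodule.topologicalClosure_mono h2
  rw [h] at h3
  exact h3

theorem norm_kerSum_sq (f : H →₀ ℂ) : ‖Φ.kerSum H f‖ ^ 2
    = (f.sum fun x a => f.sum fun y b => star a * Φ ⟪y, x⟫_ℂ * b).re := by
  rw [← inner_self_eq_norm_sq (𝕜 := ℂ), kerSum, Finsupp.linearCombination_apply]
  simp only [Finsupp.sum, sum_inner, inner_sum, inner_smul_left, inner_smul_right,
    inner_ker, ker_apply]
  refine congrArg Complex.re ?_
  simp only [Finset.mul_sum]
  rw [Finset.sum_comm]
  refine Finset.sum_congr rfl fun x _ => Finset.sum_congr rfl fun y _ => ?_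
  simp
  ring

theorem norm_ker_sq (x : H) : ‖Φ.ker x‖ ^ 2 = (Φ ((‖x‖ ^ 2 : ℝ) : ℂ)).re := by
  rw [← inner_self_eq_norm_sq (𝕜 := ℂ), inner_ker, ker_apply, inner_self_eq_norm_sq_to_K]
  simp

theorem norm_kerSum_mapDomain_le {A : H →L[ℂ] H} {c : ℝ} (hc : ∀ k ∈ Φ.Z, ‖A‖ ^ k ≤ c)
    (f : H →₀ ℂ) : ‖Φ.kerSum H (Finsupp.lmapDomain ℂ ℂ A f)‖ ≤ c * ‖Φ.kerSum H f‖ := by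
  obtain ⟨k, hk⟩ := Φ.Z_nonempty
  have hc0 : 0 ≤ c := (by positivity : 0 ≤ ‖A‖ ^ k).trans (hc k hk)
  refine le_of_sq_le_sq ?_ (by positivity)
  rw [mul_pow, norm_kerSum_sq, norm_kerSum_sq]
  refine le_of_eq_of_le ?_ (Φ.posSemidef_sq_mul_sub hc f)
  congr 1
  rw [Finsupp.lmapDomain_apply, Finsupp.sum_mapDomain_index (by simp)
    (by intros; simp [add_mul, Finsupp.sum_add])]
  refine Finset.sum_congr rfl fun x _ => ?_
  exact Finsupp.sum_mapDomain_index (by simp) (by intros; ring)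

theorem eqBounded_iff {A : H → H} {C : Φ.Space H →L[ℂ] Φ.Space H} :
    (Φ.compOp A).EqBounded C ↔ ∀ f x, C f x = f (A x) := by
  constructor
  · intro h f x
    rw [LinearPMap.EqBounded] at h
    have hf : f ∈ (Φ.compOp A).domain := by rw [h]; trivial
    have h1 : (Φ.compOp A) ⟨f, hf⟩ = C f := by
      rw [LinearPMap.ext_iff] at h
      exact h.2 (hg := trivial)
    rw [← h1]
    exact congrFun (Φ.coe_compOp_apply ⟨f, hf⟩) x
  · intro h
    refine LinearPMap.ext (Submodule.ext fun f => ⟨fun _ => trivial, fun _ => ⟨C f, funext (h f)⟩⟩) ?_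
    intro f hf hf'
    exact DFunLike.coe_injective
      ((Φ.coe_compOp_apply ⟨f, hf⟩).trans (funext fun x => (h f x).symm))

theorem exists_eqBounded {A : H →L[ℂ] H} {c : ℝ} (hc : ∀ k ∈ Φ.Z, ‖A‖ ^ k ≤ c) :
    ∃ C : Φ.Space H →L[ℂ] Φ.Space H, (Φ.compOp A).EqBounded C ∧ ‖C‖ ≤ c := by
  obtain ⟨k, hk⟩ := Φ.Z_nonempty
  have hc0 : 0 ≤ c := (by positivity : 0 ≤ ‖A‖ ^ k).trans (hc k hk)
  -- The `K_x` may be linearly dependent; the norm estimate `hb` is what makes `K_x ↦ K_{Ax}` well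
  -- defined on their span.
  set T : Φ.Space H →L[ℂ] Φ.Space H :=
    (Φ.kerSum H ∘ₗ Finsupp.lmapDomain ℂ ℂ A).extendOfNorm (Φ.kerSum H) with hT
  have hb := Φ.norm_kerSum_mapDomain_le hc
  refine ⟨ContinuousLinearMap.adjoint T, Φ.eqBounded_iff.2 fun f x => ?_, ?_⟩
  · have h1 : T (Φ.ker x) = Φ.ker (A x) := by
      rw [← kerSum_single, hT, LinearMap.extendOfNorm_eq Φ.denseRange_kerSum ⟨c, hb⟩]
      simp [kerSum_single]
    rw [← inner_ker, ContinuousLinearMap.adjoint_inner_right, h1, inner_ker]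
  · rw [LinearIsometryEquiv.norm_map]
    exact LinearMap.opNorm_extendOfNorm_le Φ.denseRange_kerSum hc0 hb

theorem norm_ker_map_le {A : H → H} {C : Φ.Space H →L[ℂ] Φ.Space H}
    (hC : (Φ.compOp A).EqBounded C) (x : H) : ‖Φ.ker (A x)‖ ≤ ‖C‖ * ‖Φ.ker x‖ := by
  have h1 : ContinuousLinearMap.adjoint C (Φ.ker x) = Φ.ker (A x) := by
    refine ext_inner_right ℂ fun f => ?_
    rw [ContinuousLinearMap.adjoint_inner_left, inner_ker, inner_ker, Φ.eqBounded_iff.1 hC]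
  rw [← h1]
  refine (ContinuousLinearMap.le_opNorm _ _).trans_eq ?_
  rw [LinearIsometryEquiv.norm_map]

end EntireF

/-! ### Operator norm, the function `q`, and Gelfand's formula -/

open Filter Topology in
-- The norm need not be attained; this lets closed conditions verified on each quotient `‖A x‖ /
-- ‖x‖` pass to `‖A‖`.
theorem ContinuousLinearMap.opNorm_mem_closure {E F : Type*} [NormedAddCommGroup E]
    [NormedSpace ℂ E] [Nontrivial E] [NormedAddCommGroup F] [NormedSpace ℂ F] (A : E →L[ℂ] F) :
    ‖A‖ ∈ closure {b | ∃ x ≠ 0, b = ‖A x‖ / ‖x‖} := by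
  rw [Metric.mem_closure_iff]
  intro ε hε
  rcases (norm_nonneg A).eq_or_lt with h0 | h0
  · obtain ⟨x, hx⟩ := exists_ne (0 : E)
    refine ⟨_, ⟨x, hx, rfl⟩, ?_⟩
    rw [norm_eq_zero.1 h0.symm]
    simpa using hε
  · obtain ⟨x, hx⟩ := A.exists_mul_lt_of_lt_opNorm (le_max_left 0 (‖A‖ - ε / 2))
      (max_lt h0 (by linarith))
    have hx0 : x ≠ 0 := by rintro rfl; simp at hx
    have hx1 : 0 < ‖x‖ := norm_pos_iff.2 hx0
    refine ⟨_, ⟨x, hx0, rfl⟩, ?_⟩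
    have h1 : ‖A x‖ / ‖x‖ ≤ ‖A‖ := (div_le_iff₀ hx1).2 (A.le_opNorm x)
    have h2 := (le_max_right 0 (‖A‖ - ε / 2)).trans_lt ((lt_div_iff₀ hx1).2 hx)
    rw [Real.dist_eq, abs_of_nonneg (by linarith)]
    linarith

theorem extPow_natCast (t : ℝ≥0∞) (k : ℕ) : extPow t k = t ^ k := rfl

theorem qFun_natCast {m M : ℕ} (h : m ≤ M) (t : ℝ≥0∞) :
    qFun m M t = max (t ^ m) (t ^ M) := by
  rw [qFun, ← ENat.natCast_sub, extPow_natCast, mul_max, mul_one, ← pow_add, Nat.add_sub_cancel' h]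

theorem qFun_top_of_le_one (m : ℕ) {t : ℝ≥0∞} (h : t ≤ 1) : qFun m ⊤ t = t ^ m := by
  have : extPow t (⊤ - m) ≤ 1 := by
    rw [ENat.top_sub_natCast]
    change (if t < 1 then (0 : ℝ≥0∞) else if t = 1 then 1 else ⊤) ≤ 1
    split_ifs with h1 h2
    · exact zero_le_one
    · exact le_rfl
    · exact absurd (h.lt_of_ne h2) h1
  rw [qFun, max_eq_left this, mul_one]

open Filter Topology in
-- In Gelfand's formula, `k`-th roots are monotone and so commute with `max`, and `t ↦ max (t ^ m)
-- (t ^ M)` is continuous.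
theorem spectralRadius_eq_max_pow {𝓐 𝓑 : Type*} [NormedRing 𝓐] [NormedAlgebra ℂ 𝓐]
    [CompleteSpace 𝓐] [NormedRing 𝓑] [NormedAlgebra ℂ 𝓑] [CompleteSpace 𝓑] {a : 𝓐} {b : 𝓑}
    {m M : ℕ} (h : ∀ k, ‖b ^ k‖ₑ = max (‖a ^ k‖ₑ ^ m) (‖a ^ k‖ₑ ^ M)) :
    spectralRadius ℂ b = max (spectralRadius ℂ a ^ m) (spectralRadius ℂ a ^ M) := by
  have ha := spectrum.pow_nnnorm_pow_one_div_tendsto_nhds_spectralRadius a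
  have hb := spectrum.pow_nnnorm_pow_one_div_tendsto_nhds_spectralRadius b
  have hc : Continuous fun t : ℝ≥0∞ => max (t ^ m) (t ^ M) :=
    (ENNReal.continuous_pow m).max (ENNReal.continuous_pow M)
  refine tendsto_nhds_unique hb (((hc.tendsto _).comp ha).congr fun k => ?_)
  have hk : (0 : ℝ) ≤ 1 / k := by positivity
  have h1 := h k
  rw [enorm_eq_nnnorm, enorm_eq_nnnorm] at h1
  rw [h1, (ENNReal.monotone_rpow_of_nonneg hk).map_max]
  simp only [Function.comp_apply, ← ENNReal.rpow_natCast, ← ENNReal.rpow_mul, mul_comm]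

/-! ### Growth of `Φ` at zero and at infinity -/

namespace EntireF

variable (Φ : EntireF)

theorem hasSum_re_ofReal (t : ℝ) : HasSum (fun k => Φ.coeff k * t ^ k) (Φ t).re := by
  convert Complex.hasSum_re (Φ.hasSum t) using 2 with k
  rw [← Complex.ofReal_pow, ← Complex.ofReal_mul, Complex.ofReal_re]

theorem minZ_mem : Φ.minZ ∈ Φ.Z := Nat.sInf_mem Φ.Z_nonempty

theorem minZ_le {k : ℕ} (hk : k ∈ Φ.Z) : Φ.minZ ≤ k := Nat.sInf_le hk

theorem le_supZ {k : ℕ} (hk : k ∈ Φ.Z) : (k : ℕ∞) ≤ Φ.supZ :=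
  le_iSup₂ (f := fun (k : ℕ) (_ : k ∈ Φ.Z) => (k : ℕ∞)) k hk

theorem exists_mem_supZ_eq (h : Φ.supZ < ⊤) : ∃ M ∈ Φ.Z, Φ.supZ = M := by
  obtain ⟨N, hN⟩ := ENat.ne_top_iff_exists.1 h.ne
  have hb : BddAbove Φ.Z := ⟨N, fun k hk => by
    have := Φ.le_supZ hk
    rw [← hN] at this
    exact_mod_cast this⟩
  have hm := Nat.sSup_mem Φ.Z_nonempty hb
  refine ⟨sSup Φ.Z, hm, le_antisymm (iSup₂_le fun k hk => ?_) (Φ.le_supZ hm)⟩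
  exact_mod_cast le_csSup hb hk

theorem exists_mem_gt (h : Φ.supZ = ⊤) (N : ℕ) : ∃ k ∈ Φ.Z, N < k := by
  by_contra! hN
  have : Φ.supZ ≤ N := iSup₂_le fun k hk => by exact_mod_cast hN k hk
  rw [h, top_le_iff] at this
  exact ENat.natCast_ne_top N this

open Filter Topology in
-- For `0 < t ≤ 1`, `a_m (b t)^m ≤ Φ(b t) ≤ c Φ(t) ≤ c (a_m t^m + t^(m+1) Φ(1))`; divide by `t^m`
-- and let `t → 0`.
theorem pow_minZ_le {b c : ℝ} (hb : 0 ≤ b) (hc : 0 ≤ c)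
    (h : ∀ t : ℝ, 0 < t → (Φ (b * t : ℝ)).re ≤ c * (Φ (t : ℝ)).re) : b ^ Φ.minZ ≤ c := by
  set m := Φ.minZ with hm
  have ham : 0 < Φ.coeff m := Φ.minZ_mem
  have key : ∀ t : ℝ, 0 < t → t ≤ 1 →
      Φ.coeff m * b ^ m ≤ c * (Φ.coeff m + t * (Φ (1 : ℝ)).re) := by
    intro t ht ht1
    have h1 : Φ.coeff m * (b * t) ^ m ≤ (Φ (b * t : ℝ)).re :=
      le_hasSum (Φ.hasSum_re_ofReal (b * t)) m fun k _ =>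
        mul_nonneg (Φ.coeff_nonneg k) (by positivity)
    have h2 : (Φ (t : ℝ)).re ≤ Φ.coeff m * t ^ m + t ^ (m + 1) * (Φ (1 : ℝ)).re := by
      refine hasSum_le (fun k => ?_) (Φ.hasSum_re_ofReal t)
        ((hasSum_ite_eq m (Φ.coeff m * t ^ m)).add
          ((Φ.hasSum_re_ofReal 1).mul_left (t ^ (m + 1))))
      have hk := Φ.coeff_nonneg k
      rcases lt_trichotomy k m with hkm | rfl | hkm
      · have : Φ.coeff k = 0 := by
          refine hk.antisymm' (not_lt.1 fun hpos => ?_)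
          exact (Φ.minZ_le hpos).not_gt hkm
        simp [this, hkm.ne]
      · simp only [if_true]
        have : 0 ≤ t ^ (m + 1) * (Φ.coeff m * 1 ^ m) := by positivity
        linarith
      · rw [if_neg hkm.ne', zero_add, one_pow, mul_one, mul_comm]
        exact mul_le_mul_of_nonneg_right (pow_le_pow_of_le_one ht.le ht1 hkm) hk
    have h3 : t ^ m * (Φ.coeff m * b ^ m) ≤ t ^ m * (c * (Φ.coeff m + t * (Φ (1 : ℝ)).re)) :=
      calc _ = Φ.coeff m * (b * t) ^ m := by rw [mul_pow]; ring
        _ ≤ c * (Φ.coeff m * t ^ m + t ^ (m + 1) * (Φ (1 : ℝ)).re) :=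
          (h1.trans (h t ht)).trans (mul_le_mul_of_nonneg_left h2 hc)
        _ = _ := by ring
    exact le_of_mul_le_mul_left h3 (by positivity)
  have hlim : Tendsto (fun t : ℝ => c * (Φ.coeff m + t * (Φ (1 : ℝ)).re)) (𝓝[>] 0)
      (𝓝 (c * (Φ.coeff m + 0 * (Φ (1 : ℝ)).re))) :=
    ((continuous_const.mul (continuous_const.add
      (continuous_id.mul continuous_const))).tendsto 0).mono_left nhdsWithin_le_nhds
  have h4 := ge_of_tendsto hlim (b := Φ.coeff m * b ^ m) (by
    filter_upwards [Ioc_mem_nhdsGT (zero_lt_one' ℝ)] with t ht using key t ht.1 ht.2)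
  rw [zero_mul, add_zero, mul_comm c] at h4
  exact le_of_mul_le_mul_left h4 ham

/-- There may be no leading term to compare. But if `c < b^(k+1)`, then `c ≤ b^l` for all `l > k`,
so in `Φ(b t) - c Φ(t)` only terms of degree at most `k` can be negative. For `t ≥ 1` they total at
least `-c t^k Φ(1)`, which the term of degree `k + 1` outgrows. -/
theorem pow_le_of_pos {b c : ℝ} (hb : 1 ≤ b) (hc : 0 ≤ c)
    (h : ∀ t : ℝ, 0 < t → (Φ (b * t : ℝ)).re ≤ c * (Φ (t : ℝ)).re) {k : ℕ}
    (hk : (k + 1) ∈ Φ.Z) : b ^ (k + 1) ≤ c := by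
  by_contra! hlt
  have hak : 0 < Φ.coeff (k + 1) := hk
  have key : ∀ t : ℝ, 1 ≤ t →
      Φ.coeff (k + 1) * (b ^ (k + 1) - c) * t ≤ c * (Φ (1 : ℝ)).re := by
    intro t ht
    have ht0 : 0 < t := by linarith
    have h1 : c * (Φ (t : ℝ)).re + Φ.coeff (k + 1) * (b ^ (k + 1) - c) * t ^ (k + 1)
        ≤ (Φ (b * t : ℝ)).re + c * t ^ k * (Φ (1 : ℝ)).re := by
      refine hasSum_le (fun l => ?_) (((Φ.hasSum_re_ofReal t).mul_left c).add
        (hasSum_ite_eq (k + 1) (Φ.coeff (k + 1) * (b ^ (k + 1) - c) * t ^ (k + 1))))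
        ((Φ.hasSum_re_ofReal (b * t)).add ((Φ.hasSum_re_ofReal 1).mul_left (c * t ^ k)))
      have hl := Φ.coeff_nonneg l
      rw [one_pow, mul_one, mul_pow]
      rcases lt_trichotomy l (k + 1) with hlk | rfl | hlk
      · rw [if_neg hlk.ne, add_zero]
        have e1 : t ^ l ≤ t ^ k := pow_le_pow_right₀ ht (Nat.lt_succ_iff.1 hlk)
        have e2 : c * Φ.coeff l * t ^ l ≤ c * Φ.coeff l * t ^ k := by gcongr
        have e3 : 0 ≤ Φ.coeff l * (b ^ l * t ^ l) := by positivity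
        nlinarith
      · rw [if_pos rfl]
        have : 0 ≤ c * t ^ k * Φ.coeff (k + 1) := by positivity
        nlinarith
      · rw [if_neg hlk.ne', add_zero]
        have e1 : c ≤ b ^ l := hlt.le.trans (pow_le_pow_right₀ hb hlk.le)
        have e2 : c * (Φ.coeff l * t ^ l) ≤ b ^ l * (Φ.coeff l * t ^ l) := by gcongr
        have e3 : 0 ≤ c * t ^ k * Φ.coeff l := by positivity
        nlinarith
    have h2 := h t ht0
    have h3 : t ^ k * (Φ.coeff (k + 1) * (b ^ (k + 1) - c) * t)
        ≤ t ^ k * (c * (Φ (1 : ℝ)).re) := by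
      rw [pow_succ t k] at h1
      nlinarith
    exact le_of_mul_le_mul_left h3 (by positivity)
  set d := Φ.coeff (k + 1) * (b ^ (k + 1) - c) with hd
  have hd0 : 0 < d := mul_pos hak (sub_pos.2 hlt)
  have h5 := key (max 1 (c * (Φ (1 : ℝ)).re / d + 1)) (le_max_left _ _)
  have h6 := mul_le_mul_of_nonneg_left (le_max_right 1 (c * (Φ (1 : ℝ)).re / d + 1)) hd0.le
  rw [mul_add, mul_div_cancel₀ _ hd0.ne'] at h6
  linarith

theorem pow_le_of_mem {b c : ℝ} (hb : 1 ≤ b) (hc : 0 ≤ c)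
    (h : ∀ t : ℝ, 0 < t → (Φ (b * t : ℝ)).re ≤ c * (Φ (t : ℝ)).re) {k : ℕ}
    (hk : k ∈ Φ.Z) : b ^ k ≤ c := by
  cases k with
  | succ k => exact Φ.pow_le_of_pos hb hc h hk
  | zero =>
    -- The bound `1 ≤ c` is read off from a nonconstant term of `Φ`.
    obtain ⟨k, hk1, hk⟩ := Φ.exists_coeff_pos
    obtain ⟨k, rfl⟩ := Nat.exists_eq_add_of_le' hk1
    rw [pow_zero]
    exact (one_le_pow₀ hb).trans (Φ.pow_le_of_pos hb hc h hk)

/-! ### Norm formulas for the composition operator -/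

variable {H : Type*} [NormedAddCommGroup H] [InnerProductSpace ℂ H]

variable {Φ} in
theorem re_le_of_eqBounded {A : H →L[ℂ] H} {C : Φ.Space H →L[ℂ] Φ.Space H}
    (hC : (Φ.compOp A).EqBounded C) {x : H} (hx : x ≠ 0) {t : ℝ} (ht : 0 < t) :
    (Φ ((‖A x‖ / ‖x‖) ^ 2 * t : ℝ)).re ≤ ‖C‖ ^ 2 * (Φ (t : ℝ)).re := by
  have hx0 : ‖x‖ ≠ 0 := norm_ne_zero_iff.2 hx
  -- Rescale `x` to a vector of squared norm `t`.
  have h := pow_le_pow_left₀ (norm_nonneg _)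
    (Φ.norm_ker_map_le hC (((√t / ‖x‖ : ℝ) : ℂ) • x)) 2
  rw [mul_pow, norm_ker_sq, norm_ker_sq, map_smul, norm_smul, norm_smul, Complex.norm_real,
    Real.norm_of_nonneg (by positivity)] at h
  have e1 : (√t / ‖x‖ * ‖A x‖) ^ 2 = (‖A x‖ / ‖x‖) ^ 2 * t := by
    rw [mul_pow, div_pow, div_pow, Real.sq_sqrt ht.le]
    ring
  rwa [e1, div_mul_cancel₀ _ hx0, Real.sq_sqrt ht.le] at h

variable {Φ} in
-- The second bound is a disjunction, not an implication from `1 < ‖A‖`, so that the condition is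
-- closed and survives the limit of quotients.
theorem norm_bounds_of_eqBounded [Nontrivial H] {A : H →L[ℂ] H} {C : Φ.Space H →L[ℂ] Φ.Space H}
    (hC : (Φ.compOp A).EqBounded C) {k : ℕ} (hk : k ∈ Φ.Z) :
    ‖A‖ ^ Φ.minZ ≤ ‖C‖ ∧ (‖A‖ ≤ 1 ∨ ‖A‖ ^ k ≤ ‖C‖) := by
  have hcl : IsClosed {t : ℝ | t ^ Φ.minZ ≤ ‖C‖ ∧ (t ≤ 1 ∨ t ^ k ≤ ‖C‖)} :=
    ((isClosed_Iic (a := ‖C‖)).preimage (continuous_pow Φ.minZ)).inter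
      (isClosed_Iic.union ((isClosed_Iic (a := ‖C‖)).preimage (continuous_pow k)))
  refine closure_minimal ?_ hcl A.opNorm_mem_closure
  rintro _ ⟨x, hx, rfl⟩
  have h0 : 0 ≤ ‖A x‖ / ‖x‖ := by positivity
  have h := fun t (ht : 0 < t) => re_le_of_eqBounded hC hx ht
  constructor
  · have := Φ.pow_minZ_le (sq_nonneg _) (sq_nonneg _) h
    rw [pow_right_comm] at this
    exact le_of_sq_le_sq this (norm_nonneg _)
  · refine or_iff_not_imp_left.2 fun h1 => ?_
    have := Φ.pow_le_of_mem (one_le_pow₀ (not_le.1 h1).le) (sq_nonneg _) h hk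
    rw [pow_right_comm] at this
    exact le_of_sq_le_sq this (norm_nonneg _)

variable {Φ} in
theorem eqBounded_unique {A : H → H} {C D : Φ.Space H →L[ℂ] Φ.Space H}
    (hC : (Φ.compOp A).EqBounded C) (hD : (Φ.compOp A).EqBounded D) : C = D :=
  ContinuousLinearMap.ext fun f => RKHS.ext fun x => by
    rw [Φ.eqBounded_iff.1 hC, Φ.eqBounded_iff.1 hD]

variable {Φ} in
theorem eqBounded_pow {A : H →L[ℂ] H} {C : Φ.Space H →L[ℂ] Φ.Space H}
    (hC : (Φ.compOp A).EqBounded C) (k : ℕ) : (Φ.compOp ⇑(A ^ k)).EqBounded (C ^ k) := by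
  rw [eqBounded_iff] at hC ⊢
  induction k with
  | zero => simp
  | succ k ih =>
    intro f x
    rw [pow_succ', pow_succ, mul_apply_eq_comp, hC, ih, mul_apply_eq_comp]

theorem pow_le_max_of_supZ_eq {M : ℕ} (hM : Φ.supZ = M) {t : ℝ} (ht : 0 ≤ t) {k : ℕ}
    (hk : k ∈ Φ.Z) : t ^ k ≤ max (t ^ Φ.minZ) (t ^ M) := by
  rcases le_total t 1 with h | h
  · exact le_max_of_le_left (pow_le_pow_of_le_one ht h (Φ.minZ_le hk))
  · refine le_max_of_le_right (pow_le_pow_right₀ h ?_)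
    have := Φ.le_supZ hk
    rw [hM] at this
    exact_mod_cast this

theorem pow_le_pow_minZ {t : ℝ} (ht : 0 ≤ t) (ht1 : t ≤ 1) {k : ℕ}
    (hk : k ∈ Φ.Z) : t ^ k ≤ t ^ Φ.minZ :=
  pow_le_pow_of_le_one ht ht1 (Φ.minZ_le hk)

variable {Φ} in
theorem norm_le_one_of_eqBounded [Nontrivial H] (htop : Φ.supZ = ⊤) {A : H →L[ℂ] H}
    {C : Φ.Space H →L[ℂ] Φ.Space H} (hC : (Φ.compOp A).EqBounded C) : ‖A‖ ≤ 1 := by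
  by_contra! h
  obtain ⟨N, hN⟩ := pow_unbounded_of_one_lt ‖C‖ h
  obtain ⟨k, hk, hNk⟩ := Φ.exists_mem_gt htop N
  rcases (norm_bounds_of_eqBounded hC hk).2 with h1 | h1
  · exact h1.not_gt h
  · exact (hN.trans_le (pow_le_pow_right₀ h.le hNk.le)).not_ge h1

variable {Φ} in
theorem enorm_eq_of_supZ_eq [Nontrivial H] {M : ℕ} (hMZ : M ∈ Φ.Z) (hM : Φ.supZ = M)
    {A : H →L[ℂ] H} {C : Φ.Space H →L[ℂ] Φ.Space H} (hC : (Φ.compOp A).EqBounded C) :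
    ‖C‖ₑ = max (‖A‖ₑ ^ Φ.minZ) (‖A‖ₑ ^ M) := by
  have h : ‖C‖ = max (‖A‖ ^ Φ.minZ) (‖A‖ ^ M) := by
    refine le_antisymm ?_ ?_
    · obtain ⟨D, hD, hle⟩ := Φ.exists_eqBounded (A := A)
        fun k hk => Φ.pow_le_max_of_supZ_eq hM (norm_nonneg A) hk
      rwa [eqBounded_unique hC hD]
    · obtain ⟨h1, h2⟩ := norm_bounds_of_eqBounded hC hMZ
      refine max_le h1 (h2.elim (fun h3 => ?_) id)
      exact (Φ.pow_le_pow_minZ (norm_nonneg A) h3 hMZ).trans h1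
  rw [← ofReal_norm, ← ofReal_norm, h, ENNReal.ofReal_max, ENNReal.ofReal_pow (norm_nonneg A),
    ENNReal.ofReal_pow (norm_nonneg A)]

variable {Φ} in
theorem enorm_eq_of_supZ_eq_top [Nontrivial H] (htop : Φ.supZ = ⊤)
    {A : H →L[ℂ] H} {C : Φ.Space H →L[ℂ] Φ.Space H} (hC : (Φ.compOp A).EqBounded C) :
    ‖C‖ₑ = ‖A‖ₑ ^ Φ.minZ := by
  have h : ‖C‖ = ‖A‖ ^ Φ.minZ := by
    refine le_antisymm ?_ (norm_bounds_of_eqBounded hC Φ.minZ_mem).1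
    obtain ⟨D, hD, hle⟩ := Φ.exists_eqBounded (A := A)
      fun k hk => Φ.pow_le_pow_minZ (norm_nonneg A) (norm_le_one_of_eqBounded htop hC) hk
    rwa [eqBounded_unique hC hD]
  rw [← ofReal_norm, ← ofReal_norm, h, ENNReal.ofReal_pow (norm_nonneg A)]

end EntireF

theorem theorem8p2 {H : Type*} [NormedAddCommGroup H] [InnerProductSpace ℂ H] [CompleteSpace H]
    [Nontrivial H] (Φ : EntireF) (A : H →L[ℂ] H) :
    (Φ.supZ < ⊤ → (Φ.compOp A).MemBounded) ∧
    (Φ.supZ = ⊤ → ((Φ.compOp A).MemBounded ↔ ‖A‖ ≤ 1)) ∧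
    (∀ C : Φ.Space H →L[ℂ] Φ.Space H, (Φ.compOp A).EqBounded C →
      ‖C‖ₑ = qFun Φ.minZ Φ.supZ ‖A‖ₑ ∧
      spectralRadius ℂ C = qFun Φ.minZ Φ.supZ (spectralRadius ℂ A)) := by
  refine ⟨fun h => ?_, fun h => ⟨fun ⟨C, hC⟩ => EntireF.norm_le_one_of_eqBounded h hC,
    fun hA => ?_⟩, fun C hC => ?_⟩
  · obtain ⟨M, -, hM⟩ := Φ.exists_mem_supZ_eq h
    obtain ⟨C, hC, -⟩ := Φ.exists_eqBounded (A := A)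
      fun k hk => Φ.pow_le_max_of_supZ_eq hM (norm_nonneg A) hk
    exact ⟨C, hC⟩
  · obtain ⟨C, hC, -⟩ := Φ.exists_eqBounded (A := A)
      fun k hk => Φ.pow_le_pow_minZ (norm_nonneg A) hA hk
    exact ⟨C, hC⟩
  · rcases eq_or_lt_of_le (le_top : Φ.supZ ≤ ⊤) with h | h
    · have hA : ‖A‖ₑ ≤ 1 := by
        rw [← ofReal_norm, ENNReal.ofReal_le_one]
        exact EntireF.norm_le_one_of_eqBounded h hC
      have hr : spectralRadius ℂ A ≤ 1 := (spectrum.spectralRadius_le_nnnorm A).trans hA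
      rw [h, qFun_top_of_le_one _ hA, qFun_top_of_le_one _ hr]
      refine ⟨EntireF.enorm_eq_of_supZ_eq_top h hC, ?_⟩
      -- Equal exponents collapse the maximum to the single power `m`.
      rw [spectralRadius_eq_max_pow (a := A) (m := Φ.minZ) (M := Φ.minZ) fun k => ?_, max_self]
      rw [max_self, EntireF.enorm_eq_of_supZ_eq_top h (EntireF.eqBounded_pow hC k)]
    · obtain ⟨M, hMZ, hM⟩ := Φ.exists_mem_supZ_eq h
      rw [hM, qFun_natCast (Φ.minZ_le hMZ), qFun_natCast (Φ.minZ_le hMZ)]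
      exact ⟨EntireF.enorm_eq_of_supZ_eq hMZ hM hC, spectralRadius_eq_max_pow fun k =>
        EntireF.enorm_eq_of_supZ_eq hMZ hM (EntireF.eqBounded_pow hC k)⟩
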